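/- Let $U$ be a finite set and let $\mathcal I\subseteq 2^U$ be a non-empty downward-closed set system. Let $\mathcal P_{\mathcal I}\subseteq[0,1]^U$ be the convex hull of the indicator vectors of the inclusion-wise maximal sets of $\mathcal I$. A probability distribution $\mathcal D$ on $2^U$ satisfies Weak Negative Regression (WNR) if for every monotone $g:2^U\to\mathbb R$ and every $i\in U$ with $0<\Pr_{S\sim\mathcal D}[i\in S]<1$, \[ \mathbb E_{S\sim\mathcal D}[g(S\setminus\{i\})\mid i\in S]\le \mathbb E_{S\sim\mathcal D}[g(S\setminus\{i\})\mid i\notin S]. \] Assume that $\mathcal I$ admits WNR distributions: for every $\mathbf x\in\mathcal P_{\mathcal I}$ there is a WNR distribution supported on $\mathcal I$ with $\Pr[i\in S]=x_i$ for all $i\in U$. Let $f:2^U\to\mathbb R_{\ge 0}$ be monotone and submodular, let $p\in[0,1]^U$, and let $R\subseteq U$ be the random set that contains each $i\in U$ independently with probability $p_i$. Probing an item $i$ reveals whether $i\in R$. An adaptive algorithm is a (possibly randomized) procedure that probes items one after another, where each next item, or the decision to stop, may depend on the outcomes of the previous probes; the set $Q$ of probed items must always belong to $\mathcal I$, and the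 value of the algorithm is $\mathbb E[f(Q\cap R)]$. A non-adaptive algorithm chooses a (possibly random) set $Q\in\mathcal I$, independently of $R$, and probes exactly the items in $Q$; its value is again $\mathbb E[f(Q\cap R)]$. Then optimal adaptive and non-adaptive algorithms exist, and their values $\mathrm{OPT}_{\mathrm{ad}}$ and $\mathrm{OPT}_{\mathrm{non}}$ satisfy \[ \mathrm{OPT}_{\mathrm{ad}}\le \frac{e}{e-1}\,\mathrm{OPT}_{\mathrm{non}}, \] that is, the adaptivity gap $\mathrm{OPT}_{\mathrm{ad}}/\mathrm{OPT}_{\mathrm{non}}$ is at most $\frac{e}{e-1}$ (where the ratio is read as $0$ if $\mathrm{OPT}_{\mathrm{non}}=0$; then also $\mathrm{OPT}_{\mathrm{ad}}=0$). -/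

import Mathlib

namespace StochasticProbing

noncomputable section

/-- Expectation of a real function under a discrete probability distribution. -/
def expect {α : Type*} (D : PMF α) (g : α → ℝ) : ℝ :=
  ∑' a, (D a).toReal * g a

open Classical in
/-- Probability of an event. -/
def prob {α : Type*} (D : PMF α) (A : Set α) : ℝ :=
  expect D (fun a => if a ∈ A then 1 else 0)

open Classical in
/-- Conditional expectation `E[g | A]`, meaningful for events with `0 < prob D A`. -/
def condExpect {α : Type*} (D : PMF α) (A : Set α) (g : α → ℝ) : ℝ :=
  expect D (fun a => if a ∈ A then g a else 0) / prob D A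

section SetSystems

variable {U : Type*} [Fintype U] [DecidableEq U]

def Submodular (f : Finset U → ℝ) : Prop :=
  ∀ S T : Finset U, f (S ∪ T) + f (S ∩ T) ≤ f S + f T

/-- Weak Negative Regression. The inequality is required for every element `i` for which both
conditional expectations are defined, i.e. both conditioning events have positive probability. -/
def IsWNR (D : PMF (Finset U)) : Prop :=
  ∀ (i : U) (f : Finset U → ℝ), Monotone f →
    0 < prob D {S | i ∈ S} → 0 < prob D {S | i ∉ S} →
      condExpect D {S | i ∈ S} (fun S => f (S.erase i)) ≤
        condExpect D {S | i ∉ S} (fun S => f (S.erase i))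

/-- Indicator vector of a set. -/
def indicatorVec (S : Finset U) : U → ℝ := fun i => if i ∈ S then 1 else 0

/-- The convex hull of the indicator vectors of the (inclusion-wise) maximal sets of `I`. -/
def polytope (I : Set (Finset U)) : Set (U → ℝ) :=
  convexHull ℝ (indicatorVec '' {S | Maximal (· ∈ I) S})

/-- Every point of the polytope is the vector of marginals of some WNR distribution over `I`. -/
def AdmitsWNR (I : Set (Finset U)) : Prop :=
  ∀ x ∈ polytope I, ∃ D : PMF (Finset U),
    (∀ S ∈ D.support, S ∈ I) ∧ IsWNR D ∧ ∀ i, prob D {S | i ∈ S} = x i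

/-- Expectation of `g R`, where the random set `R` of non-empty (active) items contains each `i`
independently with probability `p i`. -/
def expectItems (p : U → ℝ) (g : Finset U → ℝ) : ℝ :=
  ∑ R : Finset U, ((∏ i ∈ R, p i) * ∏ i ∈ Rᶜ, (1 - p i)) * g R

/-- Deterministic adaptive algorithms: stop, or probe an item and continue depending on whether
it turned out to be active or empty. -/
inductive DecisionTree (U : Type*) : Type _
  | done : DecisionTree U
  | probe (i : U) (ifActive ifEmpty : DecisionTree U) : DecisionTree U

/-- The set of items probed by a decision tree when `R` is the set of active items. -/
def DecisionTree.probed : DecisionTree U → Finset U → Finset U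
  | .done, _ => ∅
  | .probe i A B, R => insert i (if i ∈ R then A.probed R else B.probed R)

/-- Whatever the realization, the set of probed items lies in `I`. -/
def DecisionTree.Feasible (I : Set (Finset U)) (T : DecisionTree U) : Prop :=
  ∀ R : Finset U, T.probed R ∈ I

/-- Expected value of `f` on the elements contained in the probed items. -/
def DecisionTree.value (f : Finset U → ℝ) (p : U → ℝ) (T : DecisionTree U) : ℝ :=
  expectItems p (fun R => f (T.probed R ∩ R))

/-- Expected value of `f` when exactly the items of the fixed set `S` are probed. -/
def setValue (f : Finset U → ℝ) (p : U → ℝ) (S : Finset U) : ℝ :=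
  expectItems p (fun R => f (S ∩ R))

/-- The values of all (randomized) adaptive algorithms that always probe a set in `I`. -/
def adaptiveValues (I : Set (Finset U)) (f : Finset U → ℝ) (p : U → ℝ) : Set ℝ :=
  {v | ∃ A : PMF (DecisionTree U), (∀ T ∈ A.support, T.Feasible I) ∧
    v = expect A (DecisionTree.value f p)}

/-- The values of all (randomized) non-adaptive algorithms: sample a set of `I` and probe it. -/
def nonadaptiveValues (I : Set (Finset U)) (f : Finset U → ℝ) (p : U → ℝ) : Set ℝ :=
  {v | ∃ A : PMF (Finset U), (∀ S ∈ A.support, S ∈ I) ∧ v = expect A (setValue f p)}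

def adaptiveOpt (I : Set (Finset U)) (f : Finset U → ℝ) (p : U → ℝ) : ℝ :=
  sSup (adaptiveValues I f p)

def nonadaptiveOpt (I : Set (Finset U)) (f : Finset U → ℝ) (p : U → ℝ) : ℝ :=
  sSup (nonadaptiveValues I f p)

/-- The ratio of the two optima (with value `0` if the non-adaptive optimum is `0`). -/
def adaptivityGap (I : Set (Finset U)) (f : Finset U → ℝ) (p : U → ℝ) : ℝ :=
  adaptiveOpt I f p / nonadaptiveOpt I f p

end SetSystems

end

end StochasticProbing

/-! Take an adaptive algorithm with value `V`, enlarge its probed set to a maximal set of `I`, and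
let `x i` be the probability that this set contains `i`. Then `x` lies in the polytope, so some WNR
distribution `D` has marginals `x`; probing a set `Q` drawn from `D` is the non-adaptive competitor.
Both values are compared with `F(y)`, the expectation of `f` on a set containing each `i`
independently with probability `y i = x i * p i`.

Upper side: whether an item is probed is independent of whether it is active, so submodularity gives
`V ≤ f Z + ∑ y i * (f (insert i Z) - f Z)` for every `Z` (`DecisionTree.value_le`). A differential
inequality along the ray `s ↦ F(s y)` turns this into `(e - 1) V ≤ e F(y)`
(`le_expectItems_of_forall_le`).

Lower side: under WNR, replacing the items of `Q ∩ R` one at a time by independent samples with the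
same marginals never increases the expectation of a submodular function, whence `F(y) ≤ E[f(Q ∩ R)]`
(`IsWNR.expectItems_le`). -/

namespace StochasticProbing

variable {U : Type*} [Fintype U] [DecidableEq U]

/-! ### Expectations over independent items -/

/-- Probability that the set of active items is `R`. -/
noncomputable def weight (p : U → ℝ) (R : Finset U) : ℝ :=
  ∏ i, if i ∈ R then p i else 1 - p i

/-- The factors of `weight p R` that belong to items other than `i`. -/
noncomputable def weightOff (p : U → ℝ) (i : U) (R : Finset U) : ℝ :=
  ∏ j ∈ Finset.univ.erase i, if j ∈ R then p j else 1 - p j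

lemma expectItems_eq_sum_weight (p : U → ℝ) (g : Finset U → ℝ) :
    expectItems p g = ∑ R, weight p R * g R := by
  unfold expectItems weight
  refine Finset.sum_congr rfl fun R _ => ?_
  rw [Finset.prod_ite]
  congr 3 <;> ext <;> simp

lemma weight_eq_mul_weightOff (p : U → ℝ) (i : U) (R : Finset U) :
    weight p R = (if i ∈ R then p i else 1 - p i) * weightOff p i R :=
  (Finset.mul_prod_erase _ _ (Finset.mem_univ i)).symm

lemma weightOff_insert (p : U → ℝ) (i : U) (R : Finset U) :
    weightOff p i (insert i R) = weightOff p i R := by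
  refine Finset.prod_congr rfl fun j hj => ?_
  simp [Finset.ne_of_mem_erase hj]

lemma sum_finset_eq_sum_pairs (i : U) (h : Finset U → ℝ) :
    ∑ R, h R = ∑ R ∈ (Finset.univ.erase i).powerset, (h R + h (insert i R)) := by
  rw [Finset.sum_add_distrib, ← Finset.sum_powerset_insert (Finset.notMem_erase i _),
    Finset.insert_erase (Finset.mem_univ i), Finset.powerset_univ]

/-- Averaging over the state of the item `i` first does not change the expectation. -/
lemma expectItems_average (p : U → ℝ) (i : U) (g : Finset U → ℝ) :
    expectItems p g =
      expectItems p fun R => p i * g (insert i R) + (1 - p i) * g (R.erase i) := by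
  simp only [expectItems_eq_sum_weight]
  rw [sum_finset_eq_sum_pairs i, sum_finset_eq_sum_pairs i]
  refine Finset.sum_congr rfl fun R hR => ?_
  have hi : i ∉ R := fun h => by simpa using Finset.mem_powerset.1 hR h
  simp only [weight_eq_mul_weightOff p i, weightOff_insert, hi, Finset.mem_insert_self, if_true,
    if_false, Finset.insert_idem, Finset.erase_insert hi, Finset.erase_eq_of_notMem hi]
  ring

lemma sum_weight (p : U → ℝ) : ∑ R, weight p R = 1 := by
  have h := Finset.prod_add p (fun i => 1 - p i) Finset.univ
  simp only [add_sub_cancel, Finset.prod_const_one, Finset.powerset_univ] at h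
  have h' := expectItems_eq_sum_weight p fun _ => 1
  simp only [mul_one] at h'
  rw [← h']
  simp only [expectItems, mul_one, Finset.compl_eq_univ_sdiff]
  exact h.symm

lemma weight_nonneg {p : U → ℝ} (hp : ∀ i, p i ∈ Set.Icc (0 : ℝ) 1) (R : Finset U) :
    0 ≤ weight p R := by
  refine Finset.prod_nonneg fun i _ => ?_
  split_ifs
  · exact (hp i).1
  · linarith [(hp i).2]

lemma expectItems_const (p : U → ℝ) (c : ℝ) : expectItems p (fun _ => c) = c := by
  rw [expectItems_eq_sum_weight, ← Finset.sum_mul, sum_weight, one_mul]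

lemma expectItems_mono {p : U → ℝ} (hp : ∀ i, p i ∈ Set.Icc (0 : ℝ) 1) {g h : Finset U → ℝ}
    (hgh : ∀ R, g R ≤ h R) : expectItems p g ≤ expectItems p h := by
  simp only [expectItems_eq_sum_weight]
  exact Finset.sum_le_sum fun R _ => mul_le_mul_of_nonneg_left (hgh R) (weight_nonneg hp R)

lemma expectItems_add (p : U → ℝ) (g h : Finset U → ℝ) :
    expectItems p (fun R => g R + h R) = expectItems p g + expectItems p h := by
  simp only [expectItems, mul_add, Finset.sum_add_distrib]

lemma expectItems_sub (p : U → ℝ) (g h : Finset U → ℝ) :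
    expectItems p (fun R => g R - h R) = expectItems p g - expectItems p h := by
  simp only [expectItems, mul_sub, Finset.sum_sub_distrib]

lemma expectItems_mul_left (p : U → ℝ) (c : ℝ) (g : Finset U → ℝ) :
    expectItems p (fun R => c * g R) = c * expectItems p g := by
  simp only [expectItems, Finset.mul_sum]
  exact Finset.sum_congr rfl fun R _ => by ring

lemma expectItems_mul_right (p : U → ℝ) (c : ℝ) (g : Finset U → ℝ) :
    expectItems p (fun R => g R * c) = expectItems p g * c := by
  simp only [mul_comm _ c, expectItems_mul_left]

lemma expectItems_sum {ι : Type*} (s : Finset ι) (p : U → ℝ) (g : ι → Finset U → ℝ) :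
    expectItems p (fun R => ∑ j ∈ s, g j R) = ∑ j ∈ s, expectItems p (g j) := by
  simp only [expectItems, Finset.mul_sum]
  exact Finset.sum_comm

lemma expectItems_sum_comm {ι : Type*} [Fintype ι] (p : U → ℝ) (w : ι → ℝ)
    (g : ι → Finset U → ℝ) :
    ∑ a, w a * expectItems p (g a) = expectItems p fun R => ∑ a, w a * g a R := by
  rw [expectItems_sum]
  exact Finset.sum_congr rfl fun a _ => (expectItems_mul_left p _ _).symm

/-- The derivative of the multilinear extension along a ray. -/
lemma hasDerivAt_expectItems (y : U → ℝ) (f : Finset U → ℝ) (t : ℝ) :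
    HasDerivAt (fun s : ℝ => expectItems (fun i => s * y i) f)
      (∑ i, y i * expectItems (fun i => t * y i) fun R => f (insert i R) - f (R.erase i)) t := by
  simp only [expectItems_eq_sum_weight]
  have hfac (R : Finset U) (i : U) : HasDerivAt
      (fun s : ℝ => if i ∈ R then s * y i else 1 - s * y i) (if i ∈ R then y i else -y i) t := by
    have h : HasDerivAt (fun s : ℝ => s * y i) (y i) t := by
      simpa using (hasDerivAt_id t).mul_const (y i)
    split_ifs
    · exact h
    · exact h.const_sub 1
  have hweight (R : Finset U) : HasDerivAt (fun s : ℝ => weight (fun i => s * y i) R)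
      (∑ i, weightOff (fun i => t * y i) i R * (if i ∈ R then y i else -y i)) t := by
    simpa [weight, weightOff] using
      HasDerivAt.fun_finsetProd (u := Finset.univ) fun i _ => hfac R i
  refine (HasDerivAt.fun_sum (u := Finset.univ)
    fun R _ => (hweight R).mul_const (f R)).congr_deriv ?_
  simp only [Finset.sum_mul, Finset.mul_sum]
  rw [Finset.sum_comm]
  refine Finset.sum_congr rfl fun i _ => ?_
  rw [sum_finset_eq_sum_pairs i, sum_finset_eq_sum_pairs i]
  refine Finset.sum_congr rfl fun R hR => ?_
  have hi : i ∉ R := fun h => by simpa using Finset.mem_powerset.1 hR h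
  simp only [weight_eq_mul_weightOff _ i, weightOff_insert, hi, Finset.mem_insert_self, if_true,
    if_false, Finset.insert_idem, Finset.erase_insert hi, Finset.erase_eq_of_notMem hi]
  ring

/-! ### Submodular functions -/

lemma Submodular.insert_sub_antitone {U : Type*} [DecidableEq U] {f : Finset U → ℝ} (hf : Submodular f) {i : U}
    {S T : Finset U} (hST : S ⊆ T) (hi : i ∉ T) :
    f (insert i T) - f T ≤ f (insert i S) - f S := by
  have h := hf (insert i S) T
  have h₁ : insert i S ∪ T = insert i T := by
    rw [Finset.insert_union, Finset.union_eq_right.2 hST]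
  have h₂ : insert i S ∩ T = S := by
    rw [Finset.insert_inter_of_notMem hi, Finset.inter_eq_left.2 hST]
  rw [h₁, h₂] at h
  linarith

lemma Submodular.union_le_add_sum {U : Type*} [DecidableEq U] {f : Finset U → ℝ} (hf : Submodular f) (Z W : Finset U) :
    f (Z ∪ W) ≤ f Z + ∑ i ∈ W, (f (insert i Z) - f Z) := by
  induction W using Finset.induction_on with
  | empty => simp
  | insert i W hi ih =>
    rw [Finset.sum_insert hi]
    have h := hf (Z ∪ W) (insert i Z)
    have h₁ : Z ∪ W ∪ insert i Z = Z ∪ insert i W := by grind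
    by_cases hiZ : i ∈ Z
    · have h₂ : Z ∪ insert i W = Z ∪ W := by grind
      rw [h₂, Finset.insert_eq_of_mem hiZ]
      linarith
    · have h₂ : (Z ∪ W) ∩ insert i Z = Z := by grind
      rw [h₁, h₂] at h
      linarith

/-- The correlation gap: if the value `V` is bounded by linear upper bounds of `f` at all sets,
then independent sampling attains a `1 - 1/e` fraction of `V`. -/
lemma le_expectItems_of_forall_le {f : Finset U → ℝ} (hf_nonneg : ∀ S, 0 ≤ f S)
    (hf_mono : Monotone f) {y : U → ℝ} (hy : ∀ i, y i ∈ Set.Icc (0 : ℝ) 1) {V : ℝ}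
    (hV : ∀ Z, V ≤ f Z + ∑ i, y i * (f (insert i Z) - f Z)) :
    (Real.exp 1 - 1) * V ≤ Real.exp 1 * expectItems y f := by
  set φ : ℝ → ℝ := fun s => expectItems (fun i => s * y i) f with hφ
  set φ' : ℝ → ℝ := fun s =>
    ∑ i, y i * expectItems (fun i => s * y i) fun R => f (insert i R) - f (R.erase i)
  have hderiv (t : ℝ) : HasDerivAt (fun s => Real.exp s * (φ s - V))
      (Real.exp t * (φ t - V) + Real.exp t * φ' t) t :=
    (Real.hasDerivAt_exp t).mul ((hasDerivAt_expectItems y f t).sub_const V)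
  have hgrowth {t : ℝ} (ht₀ : 0 ≤ t) (ht₁ : t ≤ 1) : V ≤ φ t + φ' t := by
    have hty (i : U) : t * y i ∈ Set.Icc (0 : ℝ) 1 :=
      ⟨mul_nonneg ht₀ (hy i).1, mul_le_one₀ ht₁ (hy i).1 (hy i).2⟩
    calc V = expectItems (fun i => t * y i) fun _ => V := (expectItems_const _ V).symm
      _ ≤ expectItems (fun i => t * y i)
            fun R => f R + ∑ i, y i * (f (insert i R) - f (R.erase i)) :=
          -- Passing from `f R` to `f (R.erase i)` only enlarges the increments, and yields those of
          -- the derivative formula.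
          expectItems_mono hty fun R => (hV R).trans <| by
            gcongr with i _
            · exact (hy i).1
            · exact hf_mono (Finset.erase_subset i R)
      _ = φ t + φ' t := by
          rw [expectItems_add, expectItems_sum]
          simp only [expectItems_mul_left, hφ, φ']
  -- `exp` is the integrating factor for `φ' ≥ V - φ`. Comparing the endpoints gives `φ 0 - V ≤ e (φ
  -- 1 - V)`, and `φ 0 ≥ 0`.
  have hmono : MonotoneOn (fun s => Real.exp s * (φ s - V)) (Set.Icc 0 1) := by
    refine monotoneOn_of_deriv_nonneg (convex_Icc 0 1)
      (fun t _ => (hderiv t).continuousAt.continuousWithinAt)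
      (fun t _ => (hderiv t).differentiableAt.differentiableWithinAt) fun t ht => ?_
    rw [interior_Icc] at ht
    rw [(hderiv t).deriv, ← mul_add]
    have := hgrowth ht.1.le ht.2.le
    exact mul_nonneg (Real.exp_pos t).le (by linarith)
  have h := hmono (Set.left_mem_Icc.2 zero_le_one) (Set.right_mem_Icc.2 zero_le_one) zero_le_one
  have h₀ : 0 ≤ φ 0 := by
    refine (expectItems_const (fun i => 0 * y i) 0).symm.trans_le ?_
    exact expectItems_mono (fun i => by simp) hf_nonneg
  have h₁ : φ 1 = expectItems y f := by simp [hφ]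
  simp only [Real.exp_zero, h₁] at h
  linarith

/-! ### Weak negative regression implies submodular dominance -/

lemma expect_eq_sum {α : Type*} [Fintype α] (D : PMF α) (g : α → ℝ) :
    expect D g = ∑ a, (D a).toReal * g a :=
  tsum_fintype _

lemma sum_toReal {α : Type*} [Fintype α] (D : PMF α) : ∑ a, (D a).toReal = 1 := by
  rw [← ENNReal.toReal_sum fun a _ => D.apply_ne_top a, ← tsum_fintype (L := .unconditional α),
    D.tsum_coe, ENNReal.toReal_one]

lemma prob_add_prob_notMem (D : PMF (Finset U)) (i : U) :
    prob D {S | i ∈ S} + prob D {S | i ∉ S} = 1 := by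
  simp only [prob, expect_eq_sum, ← Finset.sum_add_distrib]
  refine Eq.trans ?_ (sum_toReal D)
  refine Finset.sum_congr rfl fun S _ => ?_
  by_cases h : i ∈ S <;> simp [h]

lemma prob_nonneg {α : Type*} [Fintype α] (D : PMF α) (A : Set α) : 0 ≤ prob D A := by
  rw [prob, expect_eq_sum]
  exact Finset.sum_nonneg fun a _ => mul_nonneg ENNReal.toReal_nonneg (by split_ifs <;> simp)

/-- Frees the conditional expectation from the classical decidability instance in its definition. -/
lemma condExpect_eq {α : Type*} (D : PMF α) (A : Set α) [DecidablePred (· ∈ A)] (g : α → ℝ) :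
    condExpect D A g = expect D (fun a => if a ∈ A then g a else 0) / prob D A := by
  unfold condExpect
  congr!

lemma expect_ite_eq_zero {α : Type*} [Fintype α] {D : PMF α} {A : Set α}
    [DecidablePred (· ∈ A)] (h : prob D A = 0)
    (g : α → ℝ) : expect D (fun a => if a ∈ A then g a else 0) = 0 := by
  rw [prob, expect_eq_sum, Finset.sum_eq_zero_iff_of_nonneg fun a _ =>
    mul_nonneg ENNReal.toReal_nonneg (by split_ifs <;> simp)] at h
  rw [expect_eq_sum]
  refine Finset.sum_eq_zero fun a _ => ?_
  have ha := h a (Finset.mem_univ a)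
  split_ifs at ha ⊢ with hA
  · rw [mul_one] at ha
    rw [ha, zero_mul]
  · exact mul_zero _

/-- The presence of `i` is non-negatively correlated with antitone functions of the rest. -/
lemma IsWNR.expect_antitone_nonneg {D : PMF (Finset U)} (hD : IsWNR D) (i : U)
    {h : Finset U → ℝ} (hh : Antitone h) :
    0 ≤ expect D fun S => ((if i ∈ S then 1 else 0) - prob D {S | i ∈ S}) * h (S.erase i) := by
  set x := prob D {S | i ∈ S} with hx
  set z := prob D {S | i ∉ S} with hz
  have hxz : x + z = 1 := prob_add_prob_notMem D i
  set a := expect D (fun S => if S ∈ {S : Finset U | i ∈ S} then h (S.erase i) else 0) with ha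
  set b := expect D (fun S => if S ∈ {S : Finset U | i ∉ S} then h (S.erase i) else 0) with hb
  have hsplit : expect D (fun S => ((if i ∈ S then 1 else 0) - x) * h (S.erase i)) =
      z * a - x * b := by
    rw [ha, hb]
    simp only [expect_eq_sum, Finset.mul_sum, ← Finset.sum_sub_distrib]
    refine Finset.sum_congr rfl fun S _ => ?_
    rw [show z = 1 - x by linarith]
    by_cases hS : i ∈ S <;> simp [hS] <;> ring
  rw [hsplit]
  -- WNR is silent when `i` is almost surely absent or present, but then both `z * a` and `x * b`
  -- vanish.
  rcases (prob_nonneg D {S | i ∈ S}).eq_or_lt with h₀ | hxpos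
  · rw [← hx] at h₀
    rw [ha, expect_ite_eq_zero (hx.symm.trans h₀.symm), ← h₀]
    simp
  rcases (prob_nonneg D {S | i ∉ S}).eq_or_lt with h₀ | hzpos
  · rw [← hz] at h₀
    rw [hb, expect_ite_eq_zero (hz.symm.trans h₀.symm), ← h₀]
    simp
  have key := hD i (fun S => -h S) (fun S T hST => neg_le_neg (hh hST)) hxpos hzpos
  have hneg (A : Set (Finset U)) [DecidablePred (· ∈ A)] :
      expect D (fun S => if S ∈ A then -h (S.erase i) else 0) =
        -expect D (fun S => if S ∈ A then h (S.erase i) else 0) := by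
    simp only [expect_eq_sum, ← Finset.sum_neg_distrib]
    refine Finset.sum_congr rfl fun S _ => ?_
    split_ifs <;> simp
  rw [condExpect_eq, condExpect_eq, hneg, hneg] at key
  rw [div_le_div_iff₀ hxpos hzpos] at key
  linarith

/-- For a fixed active set `R`, this marginal is the antitone function fed to
`IsWNR.expect_antitone_nonneg`. -/
lemma Submodular.antitone_marginal {U : Type*} [DecidableEq U] {g : Finset U → ℝ}
    (hg : Submodular g) (i : U) (R : Finset U) :
    Antitone fun S : Finset U => g (insert i ((S ∩ R).erase i)) - g ((S ∩ R).erase i) :=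
  fun _ _ hST => hg.insert_sub_antitone
    (Finset.erase_subset_erase i (Finset.inter_subset_inter_right hST)) (Finset.notMem_erase i _)

/-- Resampling one item of `S ∩ R` independently does not increase the expectation of a
submodular function. -/
lemma IsWNR.expect_resample_le {D : PMF (Finset U)} (hD : IsWNR D) {p : U → ℝ}
    (hp : ∀ i, p i ∈ Set.Icc (0 : ℝ) 1) {g : Finset U → ℝ} (hg : Submodular g) (i : U) :
    expect D (setValue (fun S => prob D {S | i ∈ S} * p i * g (insert i S) +
      (1 - prob D {S | i ∈ S} * p i) * g (S.erase i)) p) ≤ expect D (setValue g p) := by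
  set x := prob D {S | i ∈ S} with hx
  rw [← sub_nonneg]
  simp only [expect_eq_sum, setValue]
  -- Averaging over the state of `i` in `R` isolates the marginal of `i`, with coefficient `p i`
  -- exactly when `i ∈ S`. Resampling replaces that indicator by its mean `x`.
  have havg : ∀ S : Finset U, expectItems p (fun R => g (S ∩ R)) = expectItems p fun R =>
      g ((S ∩ R).erase i) + p i * (if i ∈ S then 1 else 0) *
        (g (insert i ((S ∩ R).erase i)) - g ((S ∩ R).erase i)) := by
    intro S
    rw [expectItems_average p i]
    congr 1
    funext R
    have h₁ : S ∩ R.erase i = (S ∩ R).erase i := Finset.inter_erase i S R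
    by_cases hS : i ∈ S
    · have h₂ : S ∩ insert i R = insert i ((S ∩ R).erase i) := by grind
      rw [h₁, h₂, if_pos hS]
      ring
    · have h₂ : S ∩ insert i R = (S ∩ R).erase i := by grind
      rw [h₁, h₂, if_neg hS]
      ring
  simp only [havg]
  rw [expectItems_sum_comm, expectItems_sum_comm, ← expectItems_sub]
  refine (expectItems_const p 0).symm.trans_le ?_
  refine expectItems_mono hp fun R => ?_
  have key := mul_nonneg (hp i).1 (hD.expect_antitone_nonneg i (hg.antitone_marginal i R))
  rw [← hx, expect_eq_sum, Finset.mul_sum] at key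
  rw [← Finset.sum_sub_distrib]
  refine key.trans_eq (Finset.sum_congr rfl fun S _ => ?_)
  have h₁ : (S.erase i ∩ R).erase i = (S ∩ R).erase i := by grind
  have h₂ : insert i ((S ∩ R).erase i) = insert i (S ∩ R) := by grind
  rw [h₁, h₂]
  ring

/-- Replacing the items of `S` in `B` by independent samples with marginals `y`. -/
noncomputable def resample (y : U → ℝ) (g : Finset U → ℝ) (B S : Finset U) : ℝ :=
  expectItems y fun T => g ((S \ B) ∪ (T ∩ B))

lemma Submodular.resample {g : Finset U → ℝ} (hg : Submodular g) {y : U → ℝ}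
    (hy : ∀ i, y i ∈ Set.Icc (0 : ℝ) 1) (B : Finset U) : Submodular (resample y g B) := by
  intro S S'
  unfold StochasticProbing.resample
  rw [← expectItems_add, ← expectItems_add]
  refine expectItems_mono hy fun T => ?_
  -- For fixed `T`, the map `S ↦ (S \ B) ∪ (T ∩ B)` commutes with unions and intersections.
  have h := hg ((S \ B) ∪ (T ∩ B)) ((S' \ B) ∪ (T ∩ B))
  convert h using 3 <;> grind

lemma resample_insert (y : U → ℝ) (g : Finset U → ℝ) {B : Finset U} {i : U} (hi : i ∉ B)
    (S : Finset U) : resample y g (insert i B) S =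
      y i * resample y g B (insert i S) + (1 - y i) * resample y g B (S.erase i) := by
  unfold resample
  rw [expectItems_average y i, expectItems_add, expectItems_mul_left, expectItems_mul_left]
  congr 4 <;> funext T <;> congr 1 <;> grind

/-- Submodular dominance for the thinning of a weakly negatively regressed distribution. -/
lemma IsWNR.expectItems_le {D : PMF (Finset U)} (hD : IsWNR D) {p : U → ℝ}
    (hp : ∀ i, p i ∈ Set.Icc (0 : ℝ) 1) {g : Finset U → ℝ} (hg : Submodular g) :
    expectItems (fun i => prob D {S | i ∈ S} * p i) g ≤ expect D (setValue g p) := by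
  set y : U → ℝ := fun i => prob D {S | i ∈ S} * p i with hy_def
  have hy (i : U) : y i ∈ Set.Icc (0 : ℝ) 1 :=
    ⟨mul_nonneg (prob_nonneg D _) (hp i).1, mul_le_one₀ (by
      linarith [prob_add_prob_notMem D i, prob_nonneg D {S | i ∉ S}]) (hp i).1 (hp i).2⟩
  have key (B : Finset U) : expect D (setValue (resample y g B) p) ≤ expect D (setValue g p) := by
    induction B using Finset.induction_on with
    | empty => 
      refine le_of_eq ?_
      congr 2
      funext S
      simp [resample, expectItems_const]
    | insert i B hi ih =>
      refine le_trans ?_ ((hD.expect_resample_le hp (hg.resample hy B) i).trans ih)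
      rw [show resample y g (insert i B) = _ from funext (resample_insert y g hi)]
  refine le_of_eq_of_le ?_ (key Finset.univ)
  -- Once every item is resampled, nothing of `S` remains.
  have hconst (S : Finset U) : resample y g Finset.univ S = expectItems y g := by
    simp [resample, Finset.sdiff_eq_empty_iff_subset.2 (Finset.subset_univ S)]
  simp only [setValue, hconst, expectItems_const, expect_eq_sum, ← Finset.sum_mul, sum_toReal,
    one_mul]

/-! ### Decision trees -/

/-- The state of `i` can influence the run only after `i` has been probed. -/
lemma DecisionTree.mem_probed_congr {U : Type*} [DecidableEq U] (T : DecisionTree U) {i : U} {R R' : Finset U}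
    (h : ∀ j, j ≠ i → (j ∈ R ↔ j ∈ R')) : i ∈ T.probed R ↔ i ∈ T.probed R' := by
  induction T with
  | done => simp [probed]
  | probe j A B hA hB =>
    by_cases hj : j = i
    · simp [probed, hj]
    · by_cases hR : j ∈ R
      · simp [probed, hR, (h j hj).1 hR, hA]
      · simp [probed, hR, mt (h j hj).2 hR, hB]

/-- Whether an item is probed is independent of whether it is active. -/
lemma DecisionTree.expectItems_mem_probed_inter (T : DecisionTree U) (p : U → ℝ) (i : U) :
    expectItems p (fun R => if i ∈ T.probed R ∩ R then 1 else 0) =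
      p i * expectItems p fun R => if i ∈ T.probed R then 1 else 0 := by
  rw [expectItems_average p i, ← expectItems_mul_left]
  congr 1
  funext R
  have h : i ∈ T.probed (insert i R) ↔ i ∈ T.probed R :=
    T.mem_probed_congr fun j hj => by simp [hj]
  simp [h]

/-- Bound `f (Q ∩ R)` by `f (Z ∪ (Q ∩ R))` and linearise at `Z`. Independence is used for the probed
set only; the superset `M R` may depend on all of `R`, and enters through monotonicity. -/
lemma DecisionTree.value_le {f : Finset U → ℝ} (hf_mono : Monotone f) (hf_sub : Submodular f)
    {p : U → ℝ} (hp : ∀ i, p i ∈ Set.Icc (0 : ℝ) 1) (T : DecisionTree U)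
    {M : Finset U → Finset U} (hM : ∀ R, T.probed R ⊆ M R) (Z : Finset U) :
    T.value f p ≤ f Z + ∑ i, expectItems p (fun R => if i ∈ M R then 1 else 0) * p i *
      (f (insert i Z) - f Z) := by
  calc T.value f p
      ≤ expectItems p fun R => f Z + ∑ i, (if i ∈ T.probed R ∩ R then 1 else 0) *
          (f (insert i Z) - f Z) := by
        refine expectItems_mono hp fun R => ?_
        refine (hf_mono Finset.subset_union_right).trans
          ((hf_sub.union_le_add_sum Z (T.probed R ∩ R)).trans_eq ?_)
        simp only [ite_mul, one_mul, zero_mul, Finset.sum_ite_mem, Finset.univ_inter]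
    _ = f Z + ∑ i, p i * expectItems p (fun R => if i ∈ T.probed R then 1 else 0) *
          (f (insert i Z) - f Z) := by
        rw [expectItems_add, expectItems_const, expectItems_sum]
        simp only [expectItems_mul_right, T.expectItems_mem_probed_inter]
    _ ≤ _ := by
        refine add_le_add_right (Finset.sum_le_sum fun i _ => mul_le_mul_of_nonneg_right ?_
          (sub_nonneg.2 (hf_mono (Finset.subset_insert i Z)))) _
        rw [mul_comm]
        refine mul_le_mul_of_nonneg_right (expectItems_mono hp fun R => ?_) (hp i).1
        have := @hM R i
        split_ifs <;> simp_all

/-- The marginals of a random maximal set lie in the polytope. -/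
lemma expectItems_mem_polytope {I : Set (Finset U)} {p : U → ℝ}
    (hp : ∀ i, p i ∈ Set.Icc (0 : ℝ) 1) {M : Finset U → Finset U}
    (hM : ∀ R, Maximal (· ∈ I) (M R)) :
    (fun i => expectItems p fun R => if i ∈ M R then 1 else 0) ∈ polytope I := by
  have h := (convex_convexHull ℝ (indicatorVec '' {S | Maximal (· ∈ I) S})).sum_mem
    (t := Finset.univ) (fun R _ => weight_nonneg hp R) (sum_weight p)
    fun R _ => subset_convexHull ℝ _ ⟨M R, hM R, rfl⟩
  refine Set.mem_of_eq_of_mem ?_ h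
  funext i
  simp [expectItems_eq_sum_weight, indicatorVec]

/-! ### Optimal algorithms -/

/-- There may be infinitely many decision trees; finite range makes `v` bounded, so the series
converges and `tsum` is not the default `0`. -/
lemma expect_le_of_forall_le {α : Type*} (D : PMF α) {v : α → ℝ} (hv : (Set.range v).Finite)
    {c : ℝ} (hc : ∀ a ∈ D.support, v a ≤ c) : expect D v ≤ c := by
  have hsum : HasSum (fun a => (D a).toReal) 1 := by
    have h := (ENNReal.summable_toReal (f := D) (by simp [D.tsum_coe])).hasSum
    rwa [← ENNReal.tsum_toReal_eq D.apply_ne_top, D.tsum_coe, ENNReal.toReal_one] at h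
  obtain ⟨K, hK⟩ := (hv.image fun r => |r|).bddAbove
  have hK' (a : α) : |v a| ≤ K := hK ⟨v a, ⟨a, rfl⟩, rfl⟩
  have hsv : Summable fun a => (D a).toReal * v a :=
    Summable.of_norm_bounded (hsum.summable.mul_right K) fun a => by
      rw [norm_mul, Real.norm_of_nonneg ENNReal.toReal_nonneg]
      exact mul_le_mul_of_nonneg_left (hK' a) ENNReal.toReal_nonneg
  refine (hsv.tsum_le_tsum (fun a => ?_) (hsum.mul_right c).summable).trans_eq
    ((hsum.mul_right c).tsum_eq.trans (one_mul c))
  by_cases ha : D a = 0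
  · simp [ha]
  · exact mul_le_mul_of_nonneg_left (hc a ((D.mem_support_iff a).2 ha)) ENNReal.toReal_nonneg

lemma expect_pure {α : Type*} (a : α) (v : α → ℝ) : expect (PMF.pure a) v = v a := by
  rw [expect, tsum_eq_single a fun b hb => by simp [PMF.pure_apply, hb]]
  simp [PMF.pure_apply]

/-- If `v` takes finitely many values, some deterministic choice is optimal among all random
choices satisfying `P`. -/
lemma exists_isGreatest_expect {α : Type*} {P : α → Prop} (hP : ∃ a, P a) {v : α → ℝ}
    (hv : (Set.range v).Finite) : ∃ a, P a ∧
      IsGreatest {w | ∃ A : PMF α, (∀ b ∈ A.support, P b) ∧ w = expect A v} (v a) := by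
  obtain ⟨b, hb⟩ := hP
  obtain ⟨_, ⟨a, ha, rfl⟩, hmax⟩ := Set.exists_max_image (v '' {a | P a}) id
    (hv.subset (Set.image_subset_range _ _)) ⟨v b, b, hb, rfl⟩
  refine ⟨a, ha, ⟨PMF.pure a, by simpa using ha, (expect_pure a v).symm⟩, ?_⟩
  rintro _ ⟨A, hA, rfl⟩
  exact expect_le_of_forall_le A hv fun c hc => hmax _ ⟨c, hA c hc, rfl⟩

/-- The value depends only on the map from active sets to probed sets, and there are finitely many
such maps. -/
lemma finite_range_value (f : Finset U → ℝ) (p : U → ℝ) :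
    (Set.range (DecisionTree.value f p)).Finite := by
  refine (Set.finite_range fun q : Finset U → Finset U =>
    expectItems p fun R => f (q R ∩ R)).subset ?_
  rintro _ ⟨T, rfl⟩
  exact ⟨T.probed, rfl⟩

/-- Every decision tree is matched up to `e / (e - 1)` by a non-adaptive algorithm. -/
lemma exists_nonadaptive_ge {I : Set (Finset U)} (hI : AdmitsWNR I) {f : Finset U → ℝ}
    (hf_nonneg : ∀ S, 0 ≤ f S) (hf_mono : Monotone f) (hf_sub : Submodular f) {p : U → ℝ}
    (hp : ∀ i, p i ∈ Set.Icc (0 : ℝ) 1) {T : DecisionTree U} (hT : T.Feasible I) :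
    ∃ w ∈ nonadaptiveValues I f p, (Real.exp 1 - 1) * T.value f p ≤ Real.exp 1 * w := by
  -- The polytope is spanned by maximal sets only, so the probed set has to be enlarged.
  have hext (R : Finset U) : ∃ M, T.probed R ⊆ M ∧ Maximal (· ∈ I) M :=
    (Set.toFinite I).exists_le_maximal (hT R)
  choose M hsub hmax using hext
  obtain ⟨D, hDI, hD, hDx⟩ := hI _ (expectItems_mem_polytope hp hmax)
  refine ⟨_, ⟨D, hDI, rfl⟩, ?_⟩
  refine le_trans ?_ (mul_le_mul_of_nonneg_left (hD.expectItems_le hp hf_sub)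
    (Real.exp_pos 1).le)
  refine le_expectItems_of_forall_le hf_nonneg hf_mono (fun i => ?_) fun Z => ?_
  · exact ⟨mul_nonneg (prob_nonneg D _) (hp i).1, mul_le_one₀ (by
      linarith [prob_add_prob_notMem D i, prob_nonneg D {S | i ∉ S}]) (hp i).1 (hp i).2⟩
  · simp only [hDx]
    exact T.value_le hf_mono hf_sub hp hsub Z

end StochasticProbing

theorem theorem1p8 {U : Type*} [Fintype U] [DecidableEq U]
    (I : Set (Finset U)) (hne : I.Nonempty) (hdown : IsLowerSet I)
    (hI : StochasticProbing.AdmitsWNR I)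
    (f : Finset U → ℝ) (hf_nonneg : ∀ S, 0 ≤ f S) (hf_mono : Monotone f)
    (hf_sub : StochasticProbing.Submodular f)
    (p : U → ℝ) (hp : ∀ i, p i ∈ Set.Icc (0 : ℝ) 1) :
    -- optimal adaptive and non-adaptive algorithms exist
    IsGreatest (StochasticProbing.adaptiveValues I f p) (StochasticProbing.adaptiveOpt I f p) ∧
    IsGreatest (StochasticProbing.nonadaptiveValues I f p)
      (StochasticProbing.nonadaptiveOpt I f p) ∧
    -- the bound, also in the degenerate case of a zero non-adaptive optimum
    StochasticProbing.adaptiveOpt I f p ≤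
      Real.exp 1 / (Real.exp 1 - 1) * StochasticProbing.nonadaptiveOpt I f p ∧
    StochasticProbing.adaptivityGap I f p ≤ Real.exp 1 / (Real.exp 1 - 1) := by
  have hempty : ∅ ∈ I := by
    obtain ⟨S, hS⟩ := hne
    exact hdown (Finset.empty_subset S) hS
  obtain ⟨T, hT, hTopt⟩ := StochasticProbing.exists_isGreatest_expect
    (P := StochasticProbing.DecisionTree.Feasible I) ⟨.done, fun _ => hempty⟩
    (StochasticProbing.finite_range_value f p)
  obtain ⟨S, hS, hSopt⟩ := StochasticProbing.exists_isGreatest_expect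
    (P := (· ∈ I)) ⟨∅, hempty⟩ (Set.finite_range (StochasticProbing.setValue f p))
  have had : StochasticProbing.adaptiveOpt I f p = T.value f p := hTopt.csSup_eq
  have hnon : StochasticProbing.nonadaptiveOpt I f p = StochasticProbing.setValue f p S :=
    hSopt.csSup_eq
  have he : 0 < Real.exp 1 - 1 := sub_pos.2 (Real.one_lt_exp_iff.2 one_pos)
  have hbound : T.value f p ≤
      Real.exp 1 / (Real.exp 1 - 1) * StochasticProbing.setValue f p S := by
    obtain ⟨w, hw, hle⟩ :=
      StochasticProbing.exists_nonadaptive_ge hI hf_nonneg hf_mono hf_sub hp hT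
    rw [div_mul_eq_mul_div, le_div_iff₀ he, mul_comm]
    exact hle.trans (mul_le_mul_of_nonneg_left (hSopt.2 hw) (Real.exp_pos 1).le)
  have hnonneg : 0 ≤ StochasticProbing.setValue f p S := by
    rw [← StochasticProbing.expectItems_const p 0]
    exact StochasticProbing.expectItems_mono hp fun R => hf_nonneg _
  refine ⟨had ▸ hTopt, hnon ▸ hSopt, ?_, ?_⟩
  · rw [had, hnon]
    exact hbound
  · rw [StochasticProbing.adaptivityGap, had, hnon]
    exact div_le_of_le_mul₀ hnonneg (div_nonneg (Real.exp_pos 1).le he.le) hbound
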